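/- Let $(M,d)$ be a complete metric space with a distinguished base point $0$. Let $\mathrm{Lip}_0(M)$ be the space of Lipschitz functions $g:M\to\mathbb{C}$ with $g(0)=0$, normed by the best Lipschitz constant. For $x\in M$ let $\delta(x)\in \mathrm{Lip}_0(M)^*$ be the evaluation functional $g\mapsto g(x)$, and let $\mathcal{F}(M)\subset \mathrm{Lip}_0(M)^*$ be the norm closure of $\operatorname{span}\{\delta(x):x\in M\}$ (the Lipschitz-free space over $M$). Let $f:M\to M$ be a Lipschitz map with $f(0)=0$, and let $\widehat f:\mathcal{F}(M)\to\mathcal{F}(M)$ be the unique bounded linear operator with $\widehat f(\delta(x))=\delta(f(x))$ for all $x\in M$. Assume that $\widehat f$ is compact and that at least one of the following holds: - $M$ is bounded; - $f$ is flat at infinity, that is, for every $\varepsilon>0$ there is $R\in\mathbb{R}$ such that $d(f(x),f(y))\le\varepsilon\, d(x,y)$ for all $x,y\in M$ with $d(x,0)\ge R$ and $d(y,0)\ge R$. Let $A$ be the set of all integers $n\ge 1$ such that there is a point $x\in M$, $x\neq 0$, with $f^n(x)=x$ and $f^k(x)\neq x$ for $1\le k\le n-1$ (a periodic point of order $n$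 other than the base point). Then $A$ is finite and $$\sigma(\widehat f)\setminus\{0\}=\bigcup_{n\in A}\{z\in\mathbb{C}: z^n=1\}.$$ -/

import Mathlib

open scoped NNReal

noncomputable section

namespace LipschitzFree

variable {M : Type*} [MetricSpace M]

/-- The complex vector space of Lipschitz functions `M → ℂ` vanishing at the base point `o`. -/
def lip0Submodule (o : M) : Submodule ℂ (M → ℂ) where
  carrier := {g | (∃ K : ℝ≥0, LipschitzWith K g) ∧ g o = 0}
  add_mem' := by
    rintro g h ⟨⟨K, hK⟩, hg⟩ ⟨⟨L, hL⟩, hh⟩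
    exact ⟨⟨K + L, hK.add hL⟩, by simp [hg, hh]⟩
  zero_mem' := ⟨⟨0, LipschitzWith.const 0⟩, rfl⟩
  smul_mem' := by
    rintro c g ⟨⟨K, hK⟩, hg⟩
    refine ⟨⟨‖c‖₊ * K, ?_⟩, by simp [hg]⟩
    refine LipschitzWith.of_dist_le_mul fun x y => ?_
    have h := hK.dist_le_mul x y
    rw [Pi.smul_apply, Pi.smul_apply, dist_smul₀, NNReal.coe_mul, coe_nnnorm, mul_assoc]
    exact mul_le_mul_of_nonneg_left h (norm_nonneg c)

/-- `Lip₀(M)`, for the metric space `M` pointed at `o`, as a type of its own: it carries the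
topology of the Lipschitz norm and not the topology of pointwise convergence. -/
def Lip0 (o : M) : Type _ := lip0Submodule o

namespace Lip0

variable {o : M}

instance : AddCommGroup (Lip0 o) := inferInstanceAs (AddCommGroup (lip0Submodule o))

instance : Module ℂ (Lip0 o) := inferInstanceAs (Module ℂ (lip0Submodule o))

/-- The function underlying an element of `Lip₀(M)`. -/
def toFun (g : Lip0 o) : M → ℂ := g.1

theorem ext {g h : Lip0 o} (H : ∀ x, g.toFun x = h.toFun x) : g = h := Subtype.ext (funext H)

theorem lipschitz (g : Lip0 o) : ∃ K : ℝ≥0, LipschitzWith K g.toFun := g.2.1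

theorem map_base (g : Lip0 o) : g.toFun o = 0 := g.2.2

theorem add_apply (g h : Lip0 o) (x : M) : (g + h).toFun x = g.toFun x + h.toFun x := rfl

theorem smul_apply (c : ℂ) (g : Lip0 o) (x : M) : (c • g).toFun x = c * g.toFun x := rfl

theorem zero_apply (x : M) : (0 : Lip0 o).toFun x = 0 := rfl

/-- The Lipschitz norm `sup_{x ≠ y} |g x - g y| / d(x, y)`; a pair with `x = y` contributes
`0 / 0 = 0`, which does not change the supremum. -/
instance : Norm (Lip0 o) :=
  ⟨fun g => ⨆ p : M × M, ‖g.toFun p.1 - g.toFun p.2‖ / dist p.1 p.2⟩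

theorem norm_def (g : Lip0 o) :
    ‖g‖ = ⨆ p : M × M, ‖g.toFun p.1 - g.toFun p.2‖ / dist p.1 p.2 := rfl

theorem bddAbove (g : Lip0 o) :
    BddAbove (Set.range fun p : M × M => ‖g.toFun p.1 - g.toFun p.2‖ / dist p.1 p.2) := by
  obtain ⟨K, hK⟩ := g.lipschitz
  refine ⟨K, ?_⟩
  rintro _ ⟨p, rfl⟩
  refine div_le_of_le_mul₀ dist_nonneg K.2 ?_
  rw [← dist_eq_norm]
  exact hK.dist_le_mul p.1 p.2

theorem norm_nonneg' (g : Lip0 o) : 0 ≤ ‖g‖ :=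
  Real.iSup_nonneg fun _ => div_nonneg (norm_nonneg _) dist_nonneg

theorem norm_sub_le (g : Lip0 o) (x y : M) :
    ‖g.toFun x - g.toFun y‖ ≤ ‖g‖ * dist x y := by
  rcases eq_or_ne x y with rfl | hxy
  · simp
  · exact (div_le_iff₀ (dist_pos.2 hxy)).1 (le_ciSup g.bddAbove (x, y))

theorem norm_le {g : Lip0 o} {C : ℝ} (hC : 0 ≤ C)
    (H : ∀ x y, ‖g.toFun x - g.toFun y‖ ≤ C * dist x y) : ‖g‖ ≤ C := by
  have : Nonempty M := ⟨o⟩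
  exact ciSup_le fun p => div_le_of_le_mul₀ dist_nonneg hC (H p.1 p.2)

theorem norm_apply_le (g : Lip0 o) (x : M) : ‖g.toFun x‖ ≤ ‖g‖ * dist x o := by
  simpa [g.map_base] using g.norm_sub_le x o

theorem core : NormedSpace.Core ℂ (Lip0 o) where
  norm_nonneg := norm_nonneg'
  norm_smul c g := by
    rw [norm_def, norm_def, Real.mul_iSup_of_nonneg (norm_nonneg c)]
    congr 1
    funext p
    rw [smul_apply, smul_apply, ← mul_sub, norm_mul, mul_div_assoc]
  norm_triangle g h := by
    refine norm_le (add_nonneg g.norm_nonneg' h.norm_nonneg') fun x y => ?_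
    rw [add_apply, add_apply, add_sub_add_comm, add_mul]
    exact (norm_add_le _ _).trans (add_le_add (g.norm_sub_le x y) (h.norm_sub_le x y))
  norm_eq_zero_iff g := by
    constructor
    · intro hg
      refine ext fun x => ?_
      have := g.norm_apply_le x
      rw [hg, zero_mul] at this
      exact norm_le_zero_iff.1 this
    · rintro rfl
      exact le_antisymm (norm_le le_rfl fun x y => by simp [zero_apply]) (norm_nonneg' _)

instance : NormedAddCommGroup (Lip0 o) := NormedAddCommGroup.ofCore core

instance : NormedSpace ℂ (Lip0 o) := NormedSpace.ofCore core

end Lip0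

/-- The evaluation functional `δ(x) ∈ Lip₀(M)*`, `⟨δ(x), g⟩ = g x`. -/
def delta (o x : M) : StrongDual ℂ (Lip0 o) :=
  LinearMap.mkContinuous
    { toFun := fun g => g.toFun x
      map_add' := fun _ _ => rfl
      map_smul' := fun _ _ => rfl }
    (dist x o) fun g => (g.norm_apply_le x).trans_eq (mul_comm _ _)

theorem delta_apply (o x : M) (g : Lip0 o) : delta o x g = g.toFun x := rfl

/-- The norm closure in `Lip₀(M)*` of the linear span of the evaluation functionals. -/
def freeSubmodule (o : M) : Submodule ℂ (StrongDual ℂ (Lip0 o)) :=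
  (Submodule.span ℂ (Set.range (delta o))).topologicalClosure

/-- The Lipschitz-free space `F(M)`, with the norm of `Lip₀(M)*`. -/
def FreeSpace (o : M) : Type _ := freeSubmodule o

instance (o : M) : NormedAddCommGroup (FreeSpace o) :=
  inferInstanceAs (NormedAddCommGroup (freeSubmodule o))

instance (o : M) : NormedSpace ℂ (FreeSpace o) :=
  inferInstanceAs (NormedSpace ℂ (freeSubmodule o))

/-- The composition operator `g ↦ g ∘ f` on `Lip₀(M)`, for a Lipschitz map `f` fixing `o`. -/
def compositionOperator (o : M) (f : M → M) (hf : ∃ K : ℝ≥0, LipschitzWith K f) (ho : f o = o) :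
    Lip0 o →L[ℂ] Lip0 o :=
  LinearMap.mkContinuousOfExistsBound
    { toFun := fun g => ⟨g.toFun ∘ f, by
        obtain ⟨K, hK⟩ := hf
        obtain ⟨L, hL⟩ := g.lipschitz
        exact ⟨⟨L * K, hL.comp hK⟩, by simp [ho, g.map_base]⟩⟩
      map_add' := fun _ _ => rfl
      map_smul' := fun _ _ => rfl }
    (by
      obtain ⟨K, hK⟩ := hf
      refine ⟨K, fun g => Lip0.norm_le (mul_nonneg K.2 (norm_nonneg g)) fun x y => ?_⟩
      refine (g.norm_sub_le (f x) (f y)).trans ?_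
      calc ‖g‖ * dist (f x) (f y) ≤ ‖g‖ * (K * dist x y) :=
            mul_le_mul_of_nonneg_left (hK.dist_le_mul x y) (norm_nonneg g)
        _ = K * ‖g‖ * dist x y := by ring)

theorem delta_comp_compositionOperator (o : M) (f : M → M) (hf : ∃ K : ℝ≥0, LipschitzWith K f)
    (ho : f o = o) (x : M) :
    (delta o x).comp (compositionOperator o f hf ho) = delta o (f x) := rfl

/-- The Banach space adjoint `φ ↦ φ ∘ C_f` of the composition operator, on `Lip₀(M)*`. -/
def compositionAdjoint (o : M) (f : M → M) (hf : ∃ K : ℝ≥0, LipschitzWith K f) (ho : f o = o) :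
    StrongDual ℂ (Lip0 o) →L[ℂ] StrongDual ℂ (Lip0 o) :=
  (ContinuousLinearMap.compL ℂ (Lip0 o) (Lip0 o) ℂ).flip (compositionOperator o f hf ho)

theorem compositionAdjoint_mem (o : M) (f : M → M) (hf : ∃ K : ℝ≥0, LipschitzWith K f)
    (ho : f o = o) {φ : StrongDual ℂ (Lip0 o)} (hφ : φ ∈ freeSubmodule o) :
    compositionAdjoint o f hf ho φ ∈ freeSubmodule o := by
  have hspan : Submodule.span ℂ (Set.range (delta o)) ≤
      (Submodule.span ℂ (Set.range (delta o))).comap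
        (compositionAdjoint o f hf ho : StrongDual ℂ (Lip0 o) →ₗ[ℂ] StrongDual ℂ (Lip0 o)) := by
    refine Submodule.span_le.2 ?_
    rintro _ ⟨x, rfl⟩
    exact Submodule.subset_span ⟨f x, (delta_comp_compositionOperator o f hf ho x).symm⟩
  exact map_mem_closure (compositionAdjoint o f hf ho).continuous hφ fun ψ hψ => hspan hψ

/-- The Lipschitz operator `f̂ : F(M) → F(M)`: the restriction to `F(M)` of the adjoint of the
composition operator, i.e. the unique bounded linear operator with `f̂ (δ(x)) = δ(f x)`. -/
def lipschitzOperator (o : M) (f : M → M) (hf : ∃ K : ℝ≥0, LipschitzWith K f) (ho : f o = o) :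
    FreeSpace o →L[ℂ] FreeSpace o :=
  ((compositionAdjoint o f hf ho).comp (freeSubmodule o).subtypeL).codRestrict (freeSubmodule o)
    fun φ => compositionAdjoint_mem o f hf ho φ.2

/-- The canonical map `δ : M → F(M)`. -/
def freeDelta (o x : M) : FreeSpace o :=
  ⟨delta o x, Submodule.le_topologicalClosure _ (Submodule.subset_span ⟨x, rfl⟩)⟩

theorem lipschitzOperator_freeDelta (o : M) (f : M → M) (hf : ∃ K : ℝ≥0, LipschitzWith K f)
    (ho : f o = o) (x : M) :
    lipschitzOperator o f hf ho (freeDelta o x) = freeDelta o (f x) := rfl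

/-- `f` is flat at infinity: `d(f x, f y) / d(x, y) → 0` as `d(x, o) → ∞` and `d(y, o) → ∞`
(over `x ≠ y`; for `x = y` the inequality below is trivial). -/
def FlatAtInfinity (o : M) (f : M → M) : Prop :=
  ∀ ε : ℝ, 0 < ε → ∃ R : ℝ, ∀ x y : M, R ≤ dist x o → R ≤ dist y o →
    dist (f x) (f y) ≤ ε * dist x y

/-- The set of all `n ≥ 1` such that `f` has a periodic point of order `n` (that is, with least
period `n`) other than the base point `o`. -/
def periodicOrders (o : M) (f : M → M) : Set ℕ :=
  {n | 1 ≤ n ∧ ∃ x : M, x ≠ o ∧ f^[n] x = x ∧ ∀ k : ℕ, 1 ≤ k → k < n → f^[k] x ≠ x}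

end LipschitzFree

end

/-! Compactness of `f̂` has two metric consequences: `f` contracts by any prescribed factor below
some uniform scale (`exists_dist_map_le_of_dist_lt`), and images of bounded sets are totally
bounded. Together with boundedness or flatness at infinity, they give totally bounded orbits and
finitely many periodic points, since such points are uniformly separated. A nonzero spectral value
`z` is an eigenvalue of the transpose, that is, some nonzero Lipschitz `g` satisfies `g ∘ f = z g`.
An orbit starting where `g ≠ 0` comes close to a periodic point `q`; contraction faster than `‖z‖`
forces `g` to agree at `q` and at a point of the orbit, so `g q ≠ 0` and the period `n` of `q` gives
`z ^ n = 1`. Conversely, a cycle of length `n` and an `n`-th root of unity `z` give the eigenvector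
`∑ z⁻ᵏ δ(fᵏ x)`. -/

section CompactOperators

/-! ### Compact operators and their transposes -/

open Module End

/-- **Schauder's theorem**: the transpose of a compact operator is compact. -/
theorem IsCompactOperator.compL_flip {𝕜 E F : Type*} [RCLike 𝕜] [NormedAddCommGroup E]
    [NormedSpace 𝕜 E] [NormedAddCommGroup F] [NormedSpace 𝕜 F] {T : E →L[𝕜] F}
    (hT : IsCompactOperator T) :
    IsCompactOperator ((ContinuousLinearMap.compL 𝕜 E F 𝕜).flip T) := by
  refine (isCompactOperator_iff_isCompact_closure_image_closedBall
    ((ContinuousLinearMap.compL 𝕜 E F 𝕜).flip T : (F →L[𝕜] 𝕜) →ₗ[𝕜] (E →L[𝕜] 𝕜))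
    one_pos).2 (TotallyBounded.isCompact_of_isClosed (TotallyBounded.closure ?_) isClosed_closure)
  refine Metric.totallyBounded_iff.2 fun ε hε => ?_
  obtain ⟨K, hK, hTK⟩ := IsCompactOperator.image_closedBall_subset_compact
    (f := (T : E →ₗ[𝕜] F)) hT 1
  obtain ⟨N, -, hN, hKN⟩ := hK.finite_cover_balls (e := ε / 8) (by positivity)
  have : Fintype N := hN.fintype
  -- Restricted to the finite net `N`, the dual unit ball is a bounded set in finite dimension, so
  -- finitely many functionals approximate all the others on `N`, hence on `K`.
  let Ψ : (F →L[𝕜] 𝕜) →L[𝕜] (N → 𝕜) :=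
    ContinuousLinearMap.pi fun ν => ContinuousLinearMap.apply 𝕜 𝕜 (ν : F)
  have htb : TotallyBounded (Ψ '' Metric.closedBall 0 1) :=
    (Ψ.lipschitz.isBounded_image Metric.isBounded_closedBall).isCompact_closure.totallyBounded.subset
      subset_closure
  obtain ⟨t, htS, htf, ht⟩ := Metric.finite_approx_of_totallyBounded htb (ε / 4) (by positivity)
  choose! ψ hψ hψt using fun p (hp : p ∈ t) => htS hp
  refine ⟨(fun p => (ContinuousLinearMap.compL 𝕜 E F 𝕜).flip T (ψ p)) '' t, htf.image _, ?_⟩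
  rintro _ ⟨φ, hφ, rfl⟩
  obtain ⟨p, hp, hφp⟩ := Set.mem_iUnion₂.1 (ht ⟨φ, hφ, rfl⟩)
  refine Set.mem_iUnion₂.2 ⟨_, ⟨p, hp, rfl⟩, ?_⟩
  have hsub : ‖φ - ψ p‖ ≤ 2 := by
    have h1 := hψ p hp
    rw [mem_closedBall_zero_iff] at h1 hφ
    linarith [norm_sub_le φ (ψ p)]
  rw [mem_ball_iff_norm]
  refine lt_of_le_of_lt (ContinuousLinearMap.opNorm_le_of_unit_norm (C := ε / 2)
    (by positivity) fun x hx => ?_) (by linarith)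
  change ‖φ (T x) - ψ p (T x)‖ ≤ ε / 2
  obtain ⟨ν, hν, hxν⟩ := Set.mem_iUnion₂.1 (hKN (hTK ⟨x, by simp [hx], rfl⟩))
  rw [mem_ball_iff_norm] at hxν
  have h1 : ‖φ ν - ψ p ν‖ < ε / 4 := by
    rw [← hψt p hp, mem_ball_iff_norm] at hφp
    exact (norm_le_pi_norm (Ψ φ - Ψ (ψ p)) ⟨ν, hν⟩).trans_lt hφp
  have h2 : ‖(φ - ψ p) (T x - ν)‖ ≤ 2 * (ε / 8) :=
    ((φ - ψ p).le_opNorm _).trans (mul_le_mul hsub hxν.le (norm_nonneg _) zero_le_two)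
  calc ‖φ (T x) - ψ p (T x)‖ = ‖(φ - ψ p) (T x - ν) + (φ ν - ψ p ν)‖ := by
        congr 1; simp only [map_sub, sub_apply]; ring
    _ ≤ 2 * (ε / 8) + ε / 4 := (norm_add_le _ _).trans (add_le_add h2 h1.le)
    _ = ε / 2 := by ring

/-- A nonzero spectral value of a compact operator is an eigenvalue of its transpose. -/
theorem IsCompactOperator.exists_dual_eigenvector {𝕜 E : Type*} [RCLike 𝕜]
    [NormedAddCommGroup E] [NormedSpace 𝕜 E] [CompleteSpace E] {T : E →L[𝕜] E}
    (hT : IsCompactOperator T) {μ : 𝕜} (hμ : μ ≠ 0) (h : μ ∈ spectrum 𝕜 T) :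
    ∃ φ : StrongDual 𝕜 E, φ ≠ 0 ∧ ∀ x, φ (T x) = μ * φ x := by
  obtain ⟨v, hv⟩ := ((hT.hasEigenvalue_iff_mem_spectrum hμ).2 h).exists_hasEigenvector
  have hvT : T v = μ • v := hv.apply_eq_smul
  rcases hT.compL_flip.hasEigenvalue_or_mem_resolventSet hμ with h' | h'
  · obtain ⟨φ, hφ⟩ := h'.exists_hasEigenvector
    exact ⟨φ, hφ.2, fun x => DFunLike.congr_fun hφ.apply_eq_smul x⟩
  · rw [spectrum.mem_resolventSet_iff, ContinuousLinearMap.isUnit_iff_bijective] at h'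
    -- If `μ - Tᵗ` were onto, every functional would be of the form `μψ - ψ ∘ T` and would kill the
    -- eigenvector `v`.
    refine absurd ?_ hv.2
    refine SeparatingDual.eq_zero_of_forall_dual_eq_zero (R := 𝕜) fun φ => ?_
    obtain ⟨ψ, rfl⟩ := h'.2 φ
    change μ • ψ v - ψ (T v) = 0
    rw [hvT, map_smul, sub_self]

end CompactOperators

theorem Set.Finite.exists_pos_forall_eq_of_dist_lt {α : Type*} [MetricSpace α] {s : Set α}
    (hs : s.Finite) : ∃ r > 0, ∀ a ∈ s, ∀ b ∈ s, dist a b < r → a = b := by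
  rcases s.subsingleton_or_nontrivial with h | h
  -- `infsep` takes the value 0 on a subsingleton, so this case needs its own radius.
  · exact ⟨1, one_pos, fun a ha b hb _ => h ha hb⟩
  · refine ⟨s.infsep, hs.infsep_pos_iff_nontrivial.2 h, fun a ha b hb hab => ?_⟩
    by_contra hne
    exact (Set.infsep_le_dist_of_mem ha hb hne).not_gt hab

/-! ### Metric consequences of the compactness of `f̂` -/

noncomputable section

namespace LipschitzFree

variable {M : Type*} [MetricSpace M] {o : M}

/-- A real-valued Lipschitz function vanishing at the base point, as an element of `Lip₀(M)`. -/
def Lip0.ofReal (g : M → ℝ) {K : NNReal} (hg : LipschitzWith K g) (ho : g o = 0) : Lip0 o :=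
  ⟨fun x => (g x : ℂ), ⟨K, by
    refine LipschitzWith.of_dist_le_mul fun x y => ?_
    rw [dist_eq_norm, ← Complex.ofReal_sub, Complex.norm_real, ← dist_eq_norm]
    exact hg.dist_le_mul x y⟩, by simp [ho]⟩

theorem Lip0.ofReal_apply (g : M → ℝ) {K : NNReal} (hg : LipschitzWith K g) (ho : g o = 0)
    (x : M) : (Lip0.ofReal g hg ho).toFun x = (g x : ℂ) := rfl

theorem Lip0.norm_ofReal_le (g : M → ℝ) {K : NNReal} (hg : LipschitzWith K g) (ho : g o = 0) :
    ‖Lip0.ofReal g hg ho‖ ≤ K := by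
  refine Lip0.norm_le K.2 fun x y => ?_
  rw [ofReal_apply, ofReal_apply, ← Complex.ofReal_sub, Complex.norm_real, ← dist_eq_norm]
  exact hg.dist_le_mul x y

/-- The tent function of height `r` at `u`, for `r` at most the distance to the base point. -/
def Lip0.tent (u : M) (r : ℝ) (h : r ≤ dist o u) : Lip0 o :=
  Lip0.ofReal (fun z => max (r - dist z u) 0) (K := 1)
    (by
      refine LipschitzWith.of_dist_le_mul fun x y => ?_
      rw [Real.dist_eq, NNReal.coe_one, one_mul]
      refine (abs_max_sub_max_le_abs _ _ _).trans ?_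
      rw [sub_sub_sub_cancel_left, abs_sub_comm]
      exact abs_dist_sub_le x y u)
    (max_eq_right (sub_nonpos.2 h))

theorem Lip0.norm_tent_le (u : M) (r : ℝ) (h : r ≤ dist o u) : ‖Lip0.tent u r h‖ ≤ 1 :=
  Lip0.norm_ofReal_le _ _ _

theorem Lip0.tent_apply_self (u : M) {r : ℝ} (hr : 0 ≤ r) (h : r ≤ dist o u) :
    (Lip0.tent u r h).toFun u = r := by
  simp [tent, ofReal_apply, hr]

theorem Lip0.tent_apply_of_le (u : M) {r : ℝ} (h : r ≤ dist o u) {z : M} (hz : r ≤ dist z u) :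
    (Lip0.tent u r h).toFun z = 0 := by
  simp [tent, ofReal_apply, hz]

instance : CompleteSpace (FreeSpace o) :=
  inferInstanceAs (CompleteSpace (Submodule.span ℂ (Set.range (delta o))).topologicalClosure)

/-- The inclusion of `F(M)` in the dual of `Lip₀(M)`. -/
def toDual (o : M) : FreeSpace o →L[ℂ] StrongDual ℂ (Lip0 o) := (freeSubmodule o).subtypeL

theorem norm_toDual (γ : FreeSpace o) : ‖toDual o γ‖ = ‖γ‖ := rfl

theorem toDual_freeDelta (x : M) (g : Lip0 o) : toDual o (freeDelta o x) g = g.toFun x := rfl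

/-- The lower bound is attained on the distance to `y`, shifted to vanish at `o`. -/
theorem isometry_freeDelta : Isometry (freeDelta o) := by
  refine Isometry.of_dist_eq fun x y => ?_
  rw [dist_eq_norm, ← norm_toDual, map_sub]
  refine le_antisymm (ContinuousLinearMap.opNorm_le_bound _ dist_nonneg fun g => ?_) ?_
  · exact (g.norm_sub_le x y).trans_eq (mul_comm _ _)
  · let g : Lip0 o := Lip0.ofReal (fun z => dist z y - dist o y) (K := 1)
      (LipschitzWith.of_dist_le_mul fun a b => by
        rw [Real.dist_eq, sub_sub_sub_cancel_right, NNReal.coe_one, one_mul]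
        exact abs_dist_sub_le a b y) (sub_self _)
    have hg : ‖g‖ ≤ 1 := Lip0.norm_ofReal_le _ _ _
    have h := (toDual o (freeDelta o x) - toDual o (freeDelta o y)).le_opNorm_of_le hg
    rw [sub_apply, toDual_freeDelta, toDual_freeDelta, Lip0.ofReal_apply,
      Lip0.ofReal_apply, ← Complex.ofReal_sub, Complex.norm_real] at h
    simpa using h

/-- A functional on `F(M)` that vanishes on all evaluations is zero. -/
theorem eq_zero_of_forall_freeDelta {φ : StrongDual ℂ (FreeSpace o)}
    (h : ∀ x, φ (freeDelta o x) = 0) : φ = 0 := by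
  ext γ
  let V : Submodule ℂ (StrongDual ℂ (Lip0 o)) :=
    ((LinearMap.ker (φ : FreeSpace o →ₗ[ℂ] ℂ))).map
      (toDual o : FreeSpace o →ₗ[ℂ] StrongDual ℂ (Lip0 o))
  have hspan : Submodule.span ℂ (Set.range (delta o)) ≤ V := by
    refine Submodule.span_le.2 ?_
    rintro _ ⟨x, rfl⟩
    exact ⟨freeDelta o x, h x, rfl⟩
  have hγ : toDual o γ ∈ closure (toDual o '' {γ | φ γ = 0}) :=
    closure_mono (fun ψ hψ => hspan hψ) (γ.2 : γ.1 ∈ closure _)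
  have hind : Topology.IsInducing (toDual o) := Topology.IsInducing.subtypeVal
  have hclosed : IsClosed {γ | φ γ = 0} := isClosed_eq φ.continuous continuous_const
  have hmem : γ ∈ closure {γ | φ γ = 0} := by
    rw [hind.closure_eq_preimage_closure_image]
    exact hγ
  exact hclosed.closure_subset hmem

/-- Elements of `F(M)` are almost supported on finite sets. -/
theorem exists_finite_forall_norm_le (γ : FreeSpace o) {ε : ℝ} (hε : 0 < ε) :
    ∃ F : Set M, F.Finite ∧ ∀ g : Lip0 o, ‖g‖ ≤ 1 → (∀ x ∈ F, g.toFun x = 0) →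
      ‖toDual o γ g‖ ≤ ε := by
  have hγ : toDual o γ ∈ closure (Submodule.span ℂ (Set.range (delta o)) : Set _) := γ.2
  obtain ⟨ψ, hψ, hγψ⟩ := Metric.mem_closure_iff.1 hγ ε hε
  clear hγ
  have hfin : ∃ F : Set M, F.Finite ∧ ∀ g : Lip0 o, (∀ x ∈ F, g.toFun x = 0) → ψ g = 0 := by
    clear hγψ
    induction hψ using Submodule.span_induction with
    | mem ψ h =>
      obtain ⟨x, rfl⟩ := h
      exact ⟨{x}, Set.finite_singleton x, fun g hg => hg x rfl⟩
    | zero => exact ⟨∅, Set.finite_empty, fun _ _ => rfl⟩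
    | add ψ₁ ψ₂ _ _ h₁ h₂ =>
      obtain ⟨F₁, hF₁, h₁⟩ := h₁
      obtain ⟨F₂, hF₂, h₂⟩ := h₂
      refine ⟨F₁ ∪ F₂, hF₁.union hF₂, fun g hg => ?_⟩
      rw [add_apply, h₁ g fun x hx => hg x (Or.inl hx), h₂ g fun x hx => hg x (Or.inr hx),
        add_zero]
    | smul c ψ _ h =>
      obtain ⟨F, hF, h⟩ := h
      exact ⟨F, hF, fun g hg => by rw [smul_apply, h g hg, smul_zero]⟩
  obtain ⟨F, hF, hψF⟩ := hfin
  refine ⟨F, hF, fun g hg hgF => ?_⟩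
  have h := (toDual o γ - ψ).le_opNorm_of_le hg
  rw [sub_apply, hψF g hgF, sub_zero, mul_one, ← dist_eq_norm] at h
  exact h.trans hγψ.le

section Operator

variable {f : M → M} {hf : ∃ K : NNReal, LipschitzWith K f} {ho : f o = o}

theorem toDual_lipschitzOperator_freeDelta (x : M) (g : Lip0 o) :
    toDual o (lipschitzOperator o f hf ho (freeDelta o x)) g = g.toFun (f x) := rfl

/-- If `f̂` is compact, then `g ↦ g ∘ f` is small on the functions vanishing on some finite set. -/
theorem exists_finite_forall_norm_comp_le
    (hc : IsCompactOperator (lipschitzOperator o f hf ho)) {ε : ℝ} (hε : 0 < ε) :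
    ∃ F : Set M, F.Finite ∧ o ∈ F ∧ ∀ g : Lip0 o, ‖g‖ ≤ 1 → (∀ x ∈ F, g.toFun x = 0) →
      ∀ x y, ‖g.toFun (f x) - g.toFun (f y)‖ ≤ ε * dist x y := by
  obtain ⟨K, hK, hTK⟩ := IsCompactOperator.image_closedBall_subset_compact
    (f := (lipschitzOperator o f hf ho : FreeSpace o →ₗ[ℂ] FreeSpace o)) hc 1
  obtain ⟨N, -, hN, hKN⟩ := hK.finite_cover_balls (half_pos hε)
  choose F hF hFN using fun γ : FreeSpace o => exists_finite_forall_norm_le γ (half_pos hε)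
  refine ⟨insert o (⋃ γ ∈ N, F γ), (hN.biUnion fun γ _ => hF γ).insert o, Set.mem_insert _ _,
    fun g hg hgF x y => ?_⟩
  rcases eq_or_ne x y with rfl | hxy
  · simp
  have hd : 0 < dist x y := dist_pos.2 hxy
  -- A normalised molecule: its image under `f̂` pairs with `g` to the difference quotient of `g ∘
  -- f`, and lies close to some `ν` in the finite net, on which `g` is small.
  set m : FreeSpace o := ((dist x y)⁻¹ : ℂ) • (freeDelta o x - freeDelta o y) with hm
  have hm1 : ‖m‖ ≤ 1 := by
    rw [hm, norm_smul, ← dist_eq_norm, isometry_freeDelta.dist_eq, norm_inv, Complex.norm_real,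
      Real.norm_of_nonneg dist_nonneg, inv_mul_cancel₀ hd.ne']
  obtain ⟨ν, hν, hmν⟩ := Set.mem_iUnion₂.1 (hKN (hTK ⟨m, by simpa using hm1, rfl⟩))
  have h1 : ‖toDual o ν g‖ ≤ ε / 2 :=
    hFN ν g hg fun x hx => hgF x (Set.mem_insert_of_mem _ (Set.mem_biUnion hν hx))
  have h2 : ‖toDual o (lipschitzOperator o f hf ho m - ν) g‖ ≤ ε / 2 := by
    refine ((toDual o _).le_opNorm_of_le hg).trans ?_
    rw [mul_one, norm_toDual]
    exact (mem_ball_iff_norm.1 hmν).le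
  have h3 : toDual o (lipschitzOperator o f hf ho m) g =
      ((dist x y)⁻¹ : ℂ) * (g.toFun (f x) - g.toFun (f y)) := by
    rw [hm, map_smul, map_smul, map_sub, map_sub]; rfl
  have h4 : ‖toDual o (lipschitzOperator o f hf ho m) g‖ ≤ ε := by
    have := norm_add_le (toDual o (lipschitzOperator o f hf ho m - ν) g) (toDual o ν g)
    rw [map_sub, sub_apply, sub_add_cancel] at this
    rw [map_sub, sub_apply] at h2
    linarith
  rw [h3, norm_mul, norm_inv, Complex.norm_real, Real.norm_of_nonneg dist_nonneg,
    inv_mul_le_iff₀ hd] at h4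
  linarith

/-- If `f̂` is compact, then `f` is uniformly locally flat. -/
theorem exists_dist_map_le_of_dist_lt
    (hc : IsCompactOperator (lipschitzOperator o f hf ho)) {ε : ℝ} (hε : 0 < ε) :
    ∃ δ > 0, ∀ x y, dist x y < δ → dist (f x) (f y) ≤ ε * dist x y := by
  obtain ⟨F, hF, hoF, hFε⟩ := exists_finite_forall_norm_comp_le hc (ε := ε / 4) (by positivity)
  obtain ⟨r, hr, hsep⟩ : ∃ r > 0, ∀ a ∈ F, ∀ b ∈ F, dist a b < r → a = b :=
    hF.exists_pos_forall_eq_of_dist_lt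
  obtain ⟨K, hK⟩ := hf
  -- The tent at `f x` of height `dist (f x) (f y) / 4` vanishes on `F` and at `f y`.
  have key : ∀ x y, (∀ z ∈ F, dist (f x) (f y) / 4 ≤ dist z (f x)) →
      dist (f x) (f y) ≤ ε * dist x y := by
    intro x y h
    have := hFε (Lip0.tent (f x) _ (h o hoF)) (Lip0.norm_tent_le _ _ _)
      (fun z hz => Lip0.tent_apply_of_le _ _ (h z hz)) x y
    rw [Lip0.tent_apply_self _ (by positivity), Lip0.tent_apply_of_le, sub_zero, Complex.norm_real,
      Real.norm_of_nonneg (by positivity)] at this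
    · linarith
    · rw [dist_comm (f y)]
      linarith [dist_nonneg (x := f x) (y := f y)]
  -- This scale forces `dist (f x) (f y) ≤ r / 2`; `K + 1` avoids division by zero.
  refine ⟨r / (2 * (K + 1)), by positivity, fun x y hxy => ?_⟩
  by_cases h1 : ∀ z ∈ F, dist (f x) (f y) / 4 ≤ dist z (f x)
  · exact key x y h1
  by_cases h2 : ∀ z ∈ F, dist (f y) (f x) / 4 ≤ dist z (f y)
  · rw [dist_comm (f x), dist_comm x]
    exact key y x h2
  -- Both images are now within a quarter of their distance of points `a`, `b` of `F`. Then `dist a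
  -- b < r`, so `a = b`, and the triangle inequality through `a` is contradictory.
  push Not at h1 h2
  obtain ⟨a, ha, hax⟩ := h1
  obtain ⟨b, hb, hby⟩ := h2
  have hs : dist (f x) (f y) ≤ r / 2 := by
    rw [lt_div_iff₀ (by positivity)] at hxy
    have := hK.dist_le_mul x y
    nlinarith [dist_nonneg (x := x) (y := y)]
  rw [dist_comm (f y)] at hby
  rw [dist_comm] at hax
  have h5 := dist_triangle4 a (f x) (f y) b
  have h6 := dist_triangle4 (f x) a b (f y)
  rw [dist_comm a (f x), dist_comm (f y)] at h5
  have hab : a = b := hsep a ha b hb (by linarith)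
  rw [hab, dist_self] at h6
  rw [hab] at hax
  linarith [dist_nonneg (x := f x) (y := b)]

/-- If `f̂` is compact, then `f` maps bounded sets to totally bounded sets. -/
theorem totallyBounded_image_of_isBounded
    (hc : IsCompactOperator (lipschitzOperator o f hf ho)) {B : Set M}
    (hB : Bornology.IsBounded B) : TotallyBounded (f '' B) := by
  rw [← totallyBounded_image_iff (isometry_freeDelta (o := o)).isUniformInducing]
  obtain ⟨K, hK, hTK⟩ := IsCompactOperator.image_subset_compact_of_bounded
    (f := (lipschitzOperator o f hf ho : FreeSpace o →ₗ[ℂ] FreeSpace o)) hc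
    (isometry_freeDelta.lipschitz.isBounded_image hB)
  refine hK.totallyBounded.subset (Set.Subset.trans ?_ hTK)
  rintro _ ⟨_, ⟨x, hx, rfl⟩, rfl⟩
  exact ⟨freeDelta o x, ⟨x, hx, rfl⟩, rfl⟩

end Operator

end LipschitzFree

end

/-! ### Dynamics of locally contracting maps -/

section Dynamics

open Function Filter Topology

variable {M : Type*} [MetricSpace M] {f : M → M} {ε δ : ℝ}

/-- As `ε ≤ 1`, distances never leave the range below `δ` where the contraction applies. -/
theorem dist_iterate_le_pow_mul (hε : 0 ≤ ε) (hε1 : ε ≤ 1)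
    (hflat : ∀ x y, dist x y < δ → dist (f x) (f y) ≤ ε * dist x y) {x y : M}
    (hxy : dist x y < δ) (n : ℕ) : dist (f^[n] x) (f^[n] y) ≤ ε ^ n * dist x y := by
  induction n with
  | zero => simp
  | succ n ih =>
    have hle : ε ^ n * dist x y ≤ dist x y :=
      mul_le_of_le_one_left dist_nonneg (pow_le_one₀ hε hε1)
    rw [iterate_succ_apply', iterate_succ_apply', pow_succ', mul_assoc]
    exact (hflat _ _ (ih.trans_lt (hle.trans_lt hxy))).trans (mul_le_mul_of_nonneg_left ih hε)

/-- A totally bounded orbit of a locally contracting map comes close to a periodic point. -/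
theorem exists_isPeriodicPt_dist_iterate_lt [CompleteSpace M] (hf : Continuous f) (hε : 0 ≤ ε)
    (hε1 : ε < 1) (hδ : 0 < δ) (hflat : ∀ x y, dist x y < δ → dist (f x) (f y) ≤ ε * dist x y)
    {x : M} (hx : TotallyBounded (Set.range fun n => f^[n] x)) :
    ∃ q i p, 0 < p ∧ IsPeriodicPt f p q ∧ dist (f^[i] x) q < δ := by
  have hε' : 0 < 1 - ε := sub_pos.2 hε1
  -- By pigeonhole, two orbit points are this close. The factor `1 - ε` makes the geometric series
  -- of later displacements sum to `δ / 2`, which bounds the distance to the limit `q`.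
  have hη : 0 < δ * (1 - ε) / 2 := by positivity
  obtain ⟨i, p, hp, hd⟩ : ∃ i p, 0 < p ∧ dist (f^[i] x) (f^[p] (f^[i] x)) < δ * (1 - ε) / 2 := by
    obtain ⟨t, ht, hxt⟩ := Metric.totallyBounded_iff.1 hx _ (half_pos hη)
    have hmem : ∀ n, ∃ y : t, dist (f^[n] x) y < δ * (1 - ε) / 2 / 2 := fun n => by
      obtain ⟨y, hy, hny⟩ := Set.mem_iUnion₂.1 (hxt ⟨n, rfl⟩)
      exact ⟨⟨y, hy⟩, hny⟩
    choose c hc using hmem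
    have := ht.to_subtype
    obtain ⟨i, j, hij, hcij⟩ : ∃ i j, i < j ∧ c i = c j := by
      obtain ⟨i, j, hne, h⟩ := Finite.exists_ne_map_eq_of_infinite c
      rcases hne.lt_or_gt with h' | h'
      · exact ⟨i, j, h', h⟩
      · exact ⟨j, i, h', h.symm⟩
    refine ⟨i, j - i, Nat.sub_pos_of_lt hij, ?_⟩
    rw [← iterate_add_apply, Nat.sub_add_cancel hij.le]
    have h1 := hc i
    have h2 := hc j
    rw [hcij] at h1
    linarith [dist_triangle_right (f^[i] x) (f^[j] x) (c j)]
  set y := f^[i] x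
  have hη_lt : δ * (1 - ε) / 2 < δ := by nlinarith
  have hgeom : ∀ n, dist ((f^[p])^[n] y) ((f^[p])^[n + 1] y) ≤ δ * (1 - ε) / 2 * ε ^ n := by
    intro n
    rw [iterate_succ_apply, ← iterate_mul]
    refine (dist_iterate_le_pow_mul hε hε1.le hflat (hd.trans hη_lt) _).trans ?_
    rw [mul_comm]
    exact mul_le_mul hd.le (pow_le_pow_of_le_one hε hε1.le (Nat.le_mul_of_pos_left n hp))
      (by positivity) hη.le
  obtain ⟨q, hq⟩ := cauchySeq_tendsto_of_complete (cauchySeq_of_le_geometric _ _ hε1 hgeom)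
  refine ⟨q, i, p, hp, isFixedPt_of_tendsto_iterate hq (hf.iterate p).continuousAt, ?_⟩
  refine (dist_le_of_le_geometric_of_tendsto₀ _ _ hε1 hgeom hq).trans_lt ?_
  rw [div_lt_iff₀ hε']
  nlinarith

/-- Periodic points of a locally contracting map are uniformly separated. -/
theorem eq_of_mem_periodicPts_of_dist_lt (hε : 0 ≤ ε) (hε1 : ε < 1)
    (hflat : ∀ x y, dist x y < δ → dist (f x) (f y) ≤ ε * dist x y) {x y : M}
    (hx : x ∈ periodicPts f) (hy : y ∈ periodicPts f) (hxy : dist x y < δ) : x = y := by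
  obtain ⟨m, hm, hxm⟩ := hx
  obtain ⟨n, hn, hyn⟩ := hy
  -- `m * n` is a common period, so the distance is at most a proper fraction of itself.
  have h := dist_iterate_le_pow_mul hε hε1.le hflat hxy (m * n)
  rw [(hxm.mul_const n).eq, (hyn.const_mul m).eq] at h
  have hlt : ε ^ (m * n) < 1 := pow_lt_one₀ hε hε1 (Nat.mul_pos hm hn).ne'
  by_contra hne
  exact (mul_lt_of_lt_one_left (dist_pos.2 hne) hlt).not_ge h

/-- A ball of radius `δ / 2` holds at most one periodic point, by uniform separation. -/
theorem finite_periodicPts_of_totallyBounded (hε : 0 ≤ ε) (hε1 : ε < 1) (hδ : 0 < δ)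
    (hflat : ∀ x y, dist x y < δ → dist (f x) (f y) ≤ ε * dist x y)
    (htb : TotallyBounded (periodicPts f)) : (periodicPts f).Finite := by
  obtain ⟨t, ht, hPt⟩ := Metric.totallyBounded_iff.1 htb _ (half_pos hδ)
  have hmem : ∀ x ∈ periodicPts f, ∃ y ∈ t, dist x y < δ / 2 := fun x hx => by
    obtain ⟨y, hy, hxy⟩ := Set.mem_iUnion₂.1 (hPt hx)
    exact ⟨y, hy, hxy⟩
  choose! c hct hc using hmem
  refine Set.Finite.of_finite_image (f := c)
    (ht.subset (Set.image_subset_iff.2 hct)) fun x hx y hy hxy => ?_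
  refine eq_of_mem_periodicPts_of_dist_lt hε hε1 hflat hx hy ?_
  have h1 := hc x hx
  have h2 := hc y hy
  rw [hxy] at h1
  linarith [dist_triangle_right x y (c y)]

/-- The term `2 * C` bounds the geometric sum `C + C / 2 + C / 4 + ⋯`. -/
theorem dist_iterate_le_of_dist_map_le {o : M} {C : ℝ} (hC : 0 ≤ C)
    (h : ∀ x, dist (f x) o ≤ dist x o / 2 + C) (x : M) (n : ℕ) :
    dist (f^[n] x) o ≤ (1 / 2) ^ n * dist x o + 2 * C := by
  induction n with
  | zero => simpa using hC
  | succ n ih =>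
    rw [iterate_succ_apply', pow_succ]
    linarith [h (f^[n] x)]

theorem dist_le_of_mem_periodicPts {o : M} {C : ℝ} (hC : 0 ≤ C)
    (h : ∀ x, dist (f x) o ≤ dist x o / 2 + C) {x : M} (hx : x ∈ periodicPts f) :
    dist x o ≤ 4 * C := by
  obtain ⟨n, hn, hxn⟩ := hx
  have hle := dist_iterate_le_of_dist_map_le hC h x n
  rw [hxn.eq] at hle
  have hpow : (1 / 2 : ℝ) ^ n ≤ 1 / 2 := pow_le_of_le_one (by norm_num) (by norm_num) hn.ne'
  nlinarith [dist_nonneg (x := x) (y := o)]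

end Dynamics

/-! ### Periodic points and eigenvalues -/

noncomputable section

namespace LipschitzFree

open Function Filter Topology

variable {M : Type*} [MetricSpace M] {o : M} {f : M → M}

/-- The two alternatives, boundedness and flatness, enter the proof only through this estimate,
which confines orbits and periodic points to bounded sets. -/
theorem exists_dist_map_le (hf : ∃ K : NNReal, LipschitzWith K f) (ho : f o = o)
    (h : Bornology.IsBounded (Set.univ : Set M) ∨ FlatAtInfinity o f) :
    ∃ C, 0 ≤ C ∧ ∀ x, dist (f x) o ≤ dist x o / 2 + C := by
  obtain ⟨K, hK⟩ := hf
  have hKo : ∀ x, dist (f x) o ≤ K * dist x o := fun x => by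
    simpa [ho] using hK.dist_le_mul x o
  have hbdd : ∀ R, ∀ x, dist x o ≤ R → dist (f x) o ≤ dist x o / 2 + K * |R| := fun R x hx =>
    (hKo x).trans (by
      have := mul_le_mul_of_nonneg_left (hx.trans (le_abs_self R)) K.coe_nonneg
      linarith [dist_nonneg (x := x) (y := o), this])
  rcases h with h | h
  · obtain ⟨R, hR⟩ := h.subset_closedBall o
    exact ⟨K * |R|, by positivity, fun x => hbdd R x (hR (Set.mem_univ x))⟩
  · obtain ⟨R, hR⟩ := h (1 / 2) (by norm_num)
    by_cases hy : ∃ y, R ≤ dist y o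
    -- Flatness compares only far points, so a fixed far point `y` stands in for `o`.
    · obtain ⟨y, hy⟩ := hy
      refine ⟨K * |R| + dist y o / 2 + dist (f y) o, by positivity, fun x => ?_⟩
      rcases le_total R (dist x o) with hx | hx
      · have h0 : 0 ≤ K * |R| := by positivity
        linarith [hR x y hx hy, dist_triangle (f x) (f y) o, dist_triangle_right x y o]
      · linarith [hbdd R x hx, dist_nonneg (x := y) (y := o), dist_nonneg (x := f y) (y := o)]
    · push Not at hy
      exact ⟨K * |R|, by positivity, fun x => hbdd R x (hy x).le⟩

theorem mem_periodicOrders_of_isPeriodicPt {α : Type*} {f : α → α} {o q : α} {p : ℕ}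
    (hqo : q ≠ o) (hp : 0 < p)
    (hq : IsPeriodicPt f p q) : minimalPeriod f q ∈ periodicOrders o f :=
  ⟨hq.minimalPeriod_pos hp, q, hqo, isPeriodicPt_minimalPeriod f q, fun _ hk hkn =>
    not_isPeriodicPt_of_pos_of_lt_minimalPeriod (Nat.one_le_iff_ne_zero.1 hk) hkn⟩

theorem finite_periodicOrders {α : Type*} {f : α → α} {o : α} (h : (periodicPts f).Finite) :
    (periodicOrders o f).Finite := by
  refine (h.image (minimalPeriod f)).subset ?_
  rintro n ⟨hn, x, -, hx, hmin⟩
  have hper : IsPeriodicPt f n x := hx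
  refine ⟨x, ⟨n, hn, hper⟩, le_antisymm (hper.minimalPeriod_le hn) (not_lt.1 fun hlt => ?_)⟩
  exact hmin _ (hper.minimalPeriod_pos hn) hlt (isPeriodicPt_minimalPeriod f x)

/-- A nonzero eigenvalue of `g ↦ g ∘ f` is a root of unity whose order is governed by a periodic
point of `f` other than the base point. -/
theorem exists_periodicOrders_pow_eq_one [CompleteSpace M]
    (hf : ∃ K : NNReal, LipschitzWith K f)
    (hflat : ∀ ε > 0, ∃ δ > 0, ∀ x y, dist x y < δ → dist (f x) (f y) ≤ ε * dist x y)
    (hTB : ∀ x, TotallyBounded (Set.range fun n => f^[n] x)) {z : ℂ} (hz : z ≠ 0) {g : Lip0 o}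
    (hg : g ≠ 0) (hgf : ∀ x, g.toFun (f x) = z * g.toFun x) :
    ∃ n ∈ periodicOrders o f, z ^ n = 1 := by
  have hgn : ∀ n x, g.toFun (f^[n] x) = z ^ n * g.toFun x := by
    intro n x
    induction n with
    | zero => simp
    | succ n ih => rw [iterate_succ_apply', hgf, ih, pow_succ']; ring
  obtain ⟨x, hx⟩ : ∃ x, g.toFun x ≠ 0 := by
    by_contra! h
    exact hg (Lip0.ext h)
  have hz' : 0 < ‖z‖ := norm_pos_iff.2 hz
  -- The bound `1 / 2` gives a contraction; `‖z‖ / 2` makes it outpace the factor `‖z‖ ^ n` in `g ∘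
  -- fⁿ = zⁿ g`.
  set ε := min (1 / 2) (‖z‖ / 2)
  have hε : 0 < ε := by positivity
  have hε1 : ε < 1 := (min_le_left _ _).trans_lt (by norm_num)
  obtain ⟨δ, hδ, hfδ⟩ := hflat ε hε
  obtain ⟨K, hK⟩ := hf
  obtain ⟨q, i, p, hp, hq, hd⟩ := exists_isPeriodicPt_dist_iterate_lt hK.continuous hε.le hε1 hδ
    hfδ (hTB x)
  have hle : ∀ n, ‖g.toFun (f^[i] x) - g.toFun q‖ ≤ (1 / 2) ^ n * (‖g‖ * δ) := by
    intro n
    have h1 := g.norm_sub_le (f^[n] (f^[i] x)) (f^[n] q)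
    rw [hgn n (f^[i] x), hgn n q, ← mul_sub, norm_mul, norm_pow] at h1
    have h2 : dist (f^[n] (f^[i] x)) (f^[n] q) ≤ (‖z‖ / 2) ^ n * δ :=
      (dist_iterate_le_pow_mul hε.le hε1.le hfδ hd n).trans
        (mul_le_mul (pow_le_pow_left₀ hε.le (min_le_right _ _) n) hd.le dist_nonneg (by positivity))
    refine le_of_mul_le_mul_left ?_ (pow_pos hz' n)
    calc _ ≤ ‖g‖ * ((‖z‖ / 2) ^ n * δ) := h1.trans (mul_le_mul_of_nonneg_left h2 (norm_nonneg g))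
      _ = ‖z‖ ^ n * ((1 / 2) ^ n * (‖g‖ * δ)) := by rw [div_eq_mul_one_div, mul_pow]; ring
  have hlim : Tendsto (fun n : ℕ => (1 / 2 : ℝ) ^ n * (‖g‖ * δ)) atTop (𝓝 0) := by
    simpa using (tendsto_pow_atTop_nhds_zero_of_lt_one (r := (1 / 2 : ℝ)) (by norm_num)
      (by norm_num)).mul_const (‖g‖ * δ)
  have heq : g.toFun (f^[i] x) = g.toFun q :=
    sub_eq_zero.1 (norm_le_zero_iff.1 (ge_of_tendsto' hlim hle))
  have hgq : g.toFun q ≠ 0 := by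
    rw [← heq, hgn]
    exact mul_ne_zero (pow_ne_zero i hz) hx
  have hqo : q ≠ o := by
    rintro rfl
    exact hgq g.map_base
  refine ⟨_, mem_periodicOrders_of_isPeriodicPt hqo hp hq, mul_right_cancel₀ hgq ?_⟩
  rw [← hgn, iterate_minimalPeriod, one_mul]

/-- Each periodic point other than the base point contributes eigenvectors to `f̂`. -/
theorem hasEigenvalue_of_mem_periodicOrders (hf : ∃ K : NNReal, LipschitzWith K f) (ho : f o = o)
    {n : ℕ} (hn : n ∈ periodicOrders o f) {z : ℂ} (hz : z ^ n = 1) :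
    Module.End.HasEigenvalue (lipschitzOperator o f hf ho : Module.End ℂ (FreeSpace o)) z := by
  obtain ⟨hn1, x, hxo, hxn, hmin⟩ := hn
  obtain ⟨m, rfl⟩ : ∃ m, n = m + 1 := ⟨n - 1, by omega⟩
  have hz0 : z ≠ 0 := by
    rintro rfl
    simp at hz
  -- `f̂` sends `c k` to `z • c (k + 1)`, and `z ^ n = 1` closes the cycle, so the sum over one
  -- period is an eigenvector once it is nonzero.
  let c : ℕ → FreeSpace o := fun k => (z⁻¹) ^ k • freeDelta o (f^[k] x)
  have hTc : ∀ k, lipschitzOperator o f hf ho (c k) = z • c (k + 1) := by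
    intro k
    simp only [c]
    rw [map_smul, lipschitzOperator_freeDelta, ← iterate_succ_apply' f, smul_smul, pow_succ',
      mul_inv_cancel_left₀ hz0]
  have hc : c (m + 1) = c 0 := by
    simp only [c]
    rw [inv_pow, hz, hxn]
    simp
  refine Module.End.hasEigenvalue_of_hasEigenvector
    (x := ∑ k ∈ Finset.range (m + 1), c k) ⟨Module.End.mem_eigenspace_iff.2 ?_, fun h0 => ?_⟩
  · change lipschitzOperator o f hf ho _ = _
    rw [map_sum, Finset.sum_congr rfl fun k _ => hTc k, ← Finset.smul_sum, Finset.sum_range_succ,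
      Finset.sum_range_succ' c, hc]
  -- With `r` separating the cycle and `o`, the tent at `x` sees only the term `k = 0`.
  · obtain ⟨r, hr, hsep⟩ := (((Finset.range (m + 1)).finite_toSet.image fun k => f^[k] x).insert
      o).exists_pos_forall_eq_of_dist_lt
    have hxmem : x ∈ insert o ((fun k => f^[k] x) '' (Finset.range (m + 1) : Set ℕ)) :=
      Or.inr ⟨0, by simp, rfl⟩
    have hor : r ≤ dist o x :=
      not_lt.1 fun hlt => hxo (hsep _ (Or.inl rfl) _ hxmem hlt).symm
    have h := DFunLike.congr_fun (congrArg (toDual o) h0) (Lip0.tent x r hor)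
    rw [map_sum, sum_apply, Finset.sum_range_succ',
      Finset.sum_eq_zero fun k hk => ?_] at h
    · have h2 : (Lip0.tent x r hor).toFun x = 0 := by simpa [c, toDual_freeDelta] using h
      rw [Lip0.tent_apply_self _ hr.le] at h2
      exact hr.ne' (Complex.ofReal_eq_zero.1 h2)
    · simp only [c]
      rw [map_smul, smul_apply, toDual_freeDelta, Lip0.tent_apply_of_le, smul_zero]
      refine not_lt.1 fun hlt => hmin (k + 1) (by omega)
        (by have := Finset.mem_range.1 hk; omega) (hsep _ (Or.inr ⟨k + 1, ?_, rfl⟩) _ hxmem hlt)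
      simpa using hk

end LipschitzFree

end

theorem mainTheorem1 {M : Type*} [MetricSpace M] [CompleteSpace M] (o : M) (f : M → M)
    (hf : ∃ K : NNReal, LipschitzWith K f) (ho : f o = o)
    (hcompact : IsCompactOperator (LipschitzFree.lipschitzOperator o f hf ho))
    (h : Bornology.IsBounded (Set.univ : Set M) ∨ LipschitzFree.FlatAtInfinity o f) :
    (LipschitzFree.periodicOrders o f).Finite ∧
      spectrum ℂ (LipschitzFree.lipschitzOperator o f hf ho) \ {0} =
        ⋃ n ∈ LipschitzFree.periodicOrders o f, {z : ℂ | z ^ n = 1} := by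
  have hflat : ∀ ε > 0, ∃ δ > 0, ∀ x y, dist x y < δ → dist (f x) (f y) ≤ ε * dist x y :=
    fun ε hε => LipschitzFree.exists_dist_map_le_of_dist_lt hcompact hε
  obtain ⟨C, hC, hfC⟩ := LipschitzFree.exists_dist_map_le hf ho h
  refine ⟨LipschitzFree.finite_periodicOrders ?_, Set.Subset.antisymm ?_ ?_⟩
  · obtain ⟨δ, hδ, hfδ⟩ := hflat (1 / 2) (by norm_num)
    refine finite_periodicPts_of_totallyBounded (by norm_num) (by norm_num) hδ hfδ ?_
    refine (LipschitzFree.totallyBounded_image_of_isBounded hcompact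
      (Metric.isBounded_closedBall (x := o) (r := 4 * C))).subset ?_
    intro x hx
    -- A periodic point is the image of a periodic point, so the periodic points lie in the image of
    -- a ball.
    obtain ⟨y, hy, rfl⟩ := (Function.bijOn_periodicPts f).surjOn hx
    exact ⟨y, dist_le_of_mem_periodicPts hC hfC hy, rfl⟩
  · rintro z ⟨hz, hz0 : z ≠ 0⟩
    obtain ⟨φ, hφ, hφz⟩ := hcompact.exists_dual_eigenvector hz0 hz
    -- Composition with `δ` turns the dual eigenvector into a Lipschitz solution of `g ∘ f = z g`.
    let g : LipschitzFree.Lip0 o := ⟨fun x => φ (LipschitzFree.freeDelta o x),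
      ⟨_, φ.lipschitz.comp LipschitzFree.isometry_freeDelta.lipschitz⟩, by
        have h0 : LipschitzFree.freeDelta o o = 0 :=
          Subtype.ext (ContinuousLinearMap.ext LipschitzFree.Lip0.map_base)
        exact (congrArg φ h0).trans (map_zero φ)⟩
    have hg : g ≠ 0 := fun hg => hφ (LipschitzFree.eq_zero_of_forall_freeDelta fun x =>
      congrArg (fun k => LipschitzFree.Lip0.toFun k x) hg)
    have hTB : ∀ x, TotallyBounded (Set.range fun n => f^[n] x) := by
      intro x
      have hB : Bornology.IsBounded (Set.range fun n => f^[n] x) := by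
        refine (Metric.isBounded_closedBall (x := o) (r := dist x o + 2 * C)).subset ?_
        rintro _ ⟨n, rfl⟩
        refine (dist_iterate_le_of_dist_map_le hC hfC x n).trans ?_
        gcongr
        exact mul_le_of_le_one_left dist_nonneg (pow_le_one₀ (by norm_num) (by norm_num))
      -- The orbit is `x` together with the image under `f` of the bounded orbit.
      refine ((Set.finite_singleton x).totallyBounded.union
        (LipschitzFree.totallyBounded_image_of_isBounded hcompact hB)).subset ?_
      rintro _ ⟨_ | n, rfl⟩
      · exact Or.inl rfl
      · exact Or.inr ⟨f^[n] x, ⟨n, rfl⟩, (Function.iterate_succ_apply' f n x).symm⟩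
    obtain ⟨n, hn, hzn⟩ := LipschitzFree.exists_periodicOrders_pow_eq_one hf hflat hTB hz0 hg
      fun x => hφz (LipschitzFree.freeDelta o x)
    exact Set.mem_iUnion₂.2 ⟨n, hn, hzn⟩
  · intro z hz
    obtain ⟨n, hn, hzn⟩ := Set.mem_iUnion₂.1 hz
    have hz0 : z ≠ 0 := by
      rintro rfl
      exact one_ne_zero ((zero_pow (Nat.one_le_iff_ne_zero.1 hn.1)).symm.trans hzn).symm
    exact ⟨(hcompact.hasEigenvalue_iff_mem_spectrum hz0).1
      (LipschitzFree.hasEigenvalue_of_mem_periodicOrders hf ho hn hzn), hz0⟩
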